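/- Let $q$ be a power of a prime $p$, let $\mathbb F_q$ be the finite field with $q$ elements, let $n\ge 0$ be an integer and $V_n=\mathbb F_q^n$. The functional graph $G(T/V_n)$ of a map $T:V_n\to V_n$ is the directed graph with vertex set $V_n$ and edges $v\to T(v)$. Write $T\sim S$ if $S=f^{-1}\circ T\circ f$ for some (not necessarily linear) bijection $f:V_n\to V_n$; equivalently, if the functional graphs of $S$ and $T$ are isomorphic. For a bijective linear map $T:V_n\to V_n$ there is a decomposition $V_n=\bigoplus_{i=1}^{m}U_i$ into $T$-invariant subspaces such that the minimal polynomial of $T$ on $U_i$ is $f_i^{s_i}$, where $s_i\ge 1$, $f_i\in\mathbb F_q[x]$ is monic and irreducible, $f_i\neq x$ and $\deg(f_i^{s_i})=\dim U_i$; the graph data of $T$ is the family of triples $(\deg(f_i),\operatorname{ord}(f_i),s_i)_{1\le i\le m}$, where $\operatorname{ord}(f)$ is the least $e\ge 1$ such that $f$ divides $x^e-1$. **Theorem.** Let $S,T:V_n\to V_n$ be bijective $\mathbb F_q$-linear maps such that $T\sim S$ and $G(T/V_n)$ contains no directed cycle of length divisible by $p$. Then $G(S/V_n)$ contains no directed cycle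 of length divisible by $p$ and, up to a permutation of indices, the graph data of $S$ and $T$ (for any choice of the decompositions) coincide. Moreover, if $B_q(n)$ is the number of pairwise non-isomorphic functional graphs arising from bijective $\mathbb F_q$-linear maps $V_n\to V_n$, and $\sigma_i^*$ is the number of positive integers $e$ such that $i=\min\{j>0 : q^j\equiv 1 \pmod e\}$, then $$B_q(n)\ \ge\ \sum_{\lambda\vdash n}\ \prod_{i=1}^n\binom{\sigma_i^*+\lambda_i-1}{\lambda_i},$$ where the sum runs over all partitions $\lambda=(\lambda_1,\dots,\lambda_n)$ of $n$, that is, nonnegative integers $\lambda_i$ with $\sum_{i=1}^n i\lambda_i=n$, and $\binom{-1}{0}=1$. -/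

import Mathlib

open scoped Polynomial

namespace LinearDynamics

/-- The functional graph of `T : X → X`: the vertices are the elements of `X` and the edges are
`v → T v`. -/
def functionalGraph {X : Type*} (T : X → X) : Digraph X where
  Adj v w := w = T v

/-- `G` contains a directed cycle `C_m` of length `m ≥ 1` (a loop is a cycle of length `1`):
pairwise distinct vertices `c 0, …, c (m - 1)`, indexed cyclically, with edges
`c i → c (i + 1)`. -/
def HasCycleOfLength {X : Type*} (G : Digraph X) (m : ℕ) : Prop :=
  0 < m ∧ ∃ c : ZMod m → X, Function.Injective c ∧ ∀ i, G.Adj (c i) (c (i + 1))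

/-- Two self-maps `T : Y → Y` and `S : X → X` are dynamically equivalent, `T ∼ S`, if
`S = f⁻¹ ∘ T ∘ f` for some bijection `f : X → Y`. -/
def DynEquiv {X Y : Type*} (T : Y → Y) (S : X → X) : Prop :=
  ∃ f : X ≃ Y, S = f.symm ∘ T ∘ f

/-- Isomorphism of directed graphs on the same vertex type, as an equivalence relation. -/
def digraphIsoSetoid (X : Type*) : Setoid (Digraph X) where
  r G H := Nonempty (G.Adj ≃r H.Adj)
  iseqv :=
    { refl := fun G => ⟨RelIso.refl G.Adj⟩
      symm := fun ⟨e⟩ => ⟨e.symm⟩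
      trans := fun ⟨e⟩ ⟨e'⟩ => ⟨e.trans e'⟩ }

/-- `B_q(n)` for `q = #F`: the number of isomorphism classes of functional graphs of bijective
`F`-linear maps `F^n → F^n`. -/
noncomputable def numBijectiveGraphs (F : Type*) [Field F] (n : ℕ) : ℕ :=
  Nat.card (Quotient (Setoid.comap
    (fun T : {T : Module.End F (Fin n → F) // Function.Bijective T} => functionalGraph ⇑T.1)
    (digraphIsoSetoid (Fin n → F))))

/-- The order of a polynomial `f`: the least `e ≥ 1` with `f ∣ X ^ e - 1`. Over a finite field such
an `e` exists as soon as `f` is coprime to `X`. -/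
noncomputable def polyOrder {F : Type*} [Field F] (f : F[X]) : ℕ :=
  sInf {e : ℕ | 0 < e ∧ f ∣ Polynomial.X ^ e - 1}

/-- `D` is the graph data of the linear map `T`, read off from some decomposition `V = ⨁ i, U i`
into `T`-invariant subspaces such that the minimal polynomial of `T` on `U i` is `f i ^ s i`, where
`s i ≥ 1`, `f i ≠ X` is monic irreducible and `deg (f i ^ s i) = dim (U i)`: the multiset of the
triples `(deg (f i), ord (f i), s i)`. -/
def IsGraphData {F V : Type*} [Field F] [AddCommGroup V] [Module F V] (T : Module.End F V)
    (D : Multiset (ℕ × ℕ × ℕ)) : Prop :=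
  ∃ (m : ℕ) (U : Fin m → Submodule F V) (f : Fin m → F[X]) (s : Fin m → ℕ)
    (hU : ∀ i, ∀ v ∈ U i, T v ∈ U i),
    DirectSum.IsInternal U ∧
    (∀ i, 0 < s i ∧ (f i).Monic ∧ Irreducible (f i) ∧ f i ≠ Polynomial.X ∧
      minpoly F (T.restrict (hU i)) = f i ^ s i ∧
      (f i ^ s i).natDegree = Module.finrank F (U i)) ∧
    D = (Finset.univ : Finset (Fin m)).val.map fun i => ((f i).natDegree, polyOrder (f i), s i)

/-- `σ_i^*`: the number of positive integers `e` with `ord_e q = i`, that is, such that `i` is the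
least `j > 0` with `q ^ j ≡ 1 (mod e)`. -/
noncomputable def sigmaStar (q i : ℕ) : ℕ :=
  Set.ncard {e : ℕ | 0 < e ∧ IsLeast {j : ℕ | 0 < j ∧ q ^ j ≡ 1 [MOD e]} i}

end LinearDynamics

namespace LinearDynamics

open Function Polynomial

/-! The invariant is the number of fixed points of `T^k`, for every `k`; bijective conjugation
preserves it. If no cycle length is divisible by `p`, then `T^N = 1` for some `N` prime to `p`. As
`X^N - 1` is separable, all exponents `s i` are `1`, and an elementary divisor of order `e` has
degree equal to the order of `q` mod `e` (`natDegree_eq_orderOf_card`). So the graph data is a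
function of the multiset `E` of orders alone. On an irreducible block, `T^k - 1` is zero or
invertible according to whether `e ∣ k` (`card_ptsOfPeriod_of_minpoly`), so `T^k` fixes `q^w`
points, where `w` sums the orders of `q` mod `e` over the `e ∈ E` dividing `k`
(`IsGraphData.exists_orders`). Inversion along divisibility recovers `E` from these numbers
(`multiset_eq_of_sum_filter_dvd`). For the bound, every `E` prime to `q` of total weight `n` is
realized (`exists_end_of_orders`), and distinct `E` give non-isomorphic graphs. Sorting the members
of `E` by weight `i` counts such `E` as multisets of size `λ_i` from `σ_i^*` integers. -/

/-! ### Cycles and numbers of periodic points -/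

theorem hasCycleOfLength_minimalPeriod {X : Type*} (T : X → X) (v : X)
    (h : 0 < minimalPeriod T v) :
    HasCycleOfLength (functionalGraph T) (minimalPeriod T v) := by
  refine ⟨h, fun i => T^[i.val] v, fun i j hij => ?_, fun i => ?_⟩
  · have : NeZero (minimalPeriod T v) := ⟨h.ne'⟩
    exact ZMod.val_injective _
      (iterate_injOn_Iio_minimalPeriod (ZMod.val_lt i) (ZMod.val_lt j) hij)
  · have : NeZero (minimalPeriod T v) := ⟨h.ne'⟩
    change T^[(i + 1).val] v = T (T^[i.val] v)
    rw [ZMod.val_add, iterate_mod_minimalPeriod_eq, ← iterate_succ_apply' T,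
      ← iterate_mod_minimalPeriod_eq (n := _ + _), ← iterate_mod_minimalPeriod_eq (n := _ + 1),
      ZMod.val_one_eq_one_mod, Nat.add_mod_mod]

theorem HasCycleOfLength.of_dynEquiv {X Y : Type*} {T : Y → Y} {S : X → X} (h : DynEquiv T S)
    {m : ℕ} (hc : HasCycleOfLength (functionalGraph S) m) :
    HasCycleOfLength (functionalGraph T) m := by
  obtain ⟨f, rfl⟩ := h
  obtain ⟨hm, c, hc, hadj⟩ := hc
  refine ⟨hm, f ∘ c, f.injective.comp hc, fun i => ?_⟩
  have := hadj i
  simp only [functionalGraph, comp_apply] at this ⊢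
  rw [this, Equiv.apply_symm_apply]

/-- If every cycle length of an injective self-map of a finite set is prime to `p`, then some
iterate with exponent prime to `p` is the identity. -/
theorem exists_iterate_eq_id {X : Type*} [Finite X] {T : X → X} (hT : Injective T) {p : ℕ}
    (hp : p.Prime) (h : ∀ m, HasCycleOfLength (functionalGraph T) m → ¬ p ∣ m) :
    ∃ N, 0 < N ∧ ¬ p ∣ N ∧ T^[N] = id := by
  cases nonempty_fintype X
  have hpos : ∀ v, 0 < minimalPeriod T v := fun v =>
    minimalPeriod_pos_of_mem_periodicPts (hT.mem_periodicPts v)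
  -- Each minimal period is a cycle length, so the prime `p` divides no factor of this product.
  refine ⟨∏ v, minimalPeriod T v, Finset.prod_pos fun v _ => hpos v, fun hd => ?_, ?_⟩
  · obtain ⟨v, -, hv⟩ := (Nat.prime_iff.mp hp).exists_mem_finset_dvd hd
    exact h _ (hasCycleOfLength_minimalPeriod T v (hpos v)) hv
  · funext v
    exact (isPeriodicPt_minimalPeriod T v).trans_dvd (Finset.dvd_prod_of_mem _ (Finset.mem_univ v))

theorem card_ptsOfPeriod_congr {X Y : Type*} {T : X → X} {S : Y → Y} (e : X ≃ Y)
    (h : Semiconj e T S) (k : ℕ) : Nat.card (ptsOfPeriod T k) = Nat.card (ptsOfPeriod S k) := by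
  refine Nat.card_congr (e.subtypeEquiv fun x => ?_)
  change T^[k] x = x ↔ S^[k] (e x) = e x
  rw [← h.iterate_right k x, e.apply_eq_iff_eq]

theorem card_ptsOfPeriod_pi {ι : Type*} [Fintype ι] {W : ι → Type*} (A : ∀ i, W i → W i) (k : ℕ) :
    Nat.card (ptsOfPeriod (Pi.map A) k) = ∏ i, Nat.card (ptsOfPeriod (A i) k) := by
  rw [← Nat.card_pi]
  refine Nat.card_congr ((Equiv.subtypeEquivRight fun v => ?_).trans
    (Equiv.subtypePiEquivPi (p := fun {i} x => x ∈ ptsOfPeriod (A i) k)))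
  change (Pi.map A)^[k] v = v ↔ ∀ i, (A i)^[k] (v i) = v i
  rw [Pi.map_iterate, funext_iff]
  rfl

theorem card_ptsOfPeriod_prodMap {X Y : Type*} (A : X → X) (B : Y → Y) (k : ℕ) :
    Nat.card (ptsOfPeriod (Prod.map A B) k) =
      Nat.card (ptsOfPeriod A k) * Nat.card (ptsOfPeriod B k) := by
  rw [← Nat.card_prod]
  refine Nat.card_congr ((Equiv.subtypeEquivRight fun v => ?_).trans
    (Equiv.subtypeProdEquivProd (p := (· ∈ ptsOfPeriod A k)) (q := (· ∈ ptsOfPeriod B k))))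
  change (Prod.map A B)^[k] v = v ↔ A^[k] v.1 = v.1 ∧ B^[k] v.2 = v.2
  rw [Prod.map_iterate, Prod.ext_iff]
  rfl

/-! ### Inversion along divisibility -/

/-- A multiset of positive integers is determined by its weighted numbers of divisors of each
`k`. -/
theorem multiset_eq_of_sum_filter_dvd (w : ℕ → ℕ) {E E' : Multiset ℕ}
    (hE : ∀ e ∈ E, 0 < e ∧ 0 < w e) (hE' : ∀ e ∈ E', 0 < e ∧ 0 < w e)
    (h : ∀ k, 0 < k → ((E.filter (· ∣ k)).map w).sum = ((E'.filter (· ∣ k)).map w).sum) :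
    E = E' := by
  have key : ∀ (E : Multiset ℕ) (k : ℕ), 0 < k →
      ((E.filter (· ∣ k)).map w).sum = ∑ e ∈ k.divisors, E.count e * w e := by
    intro E k hk
    rw [Finset.sum_multiset_map_count]
    refine (Finset.sum_subset (fun e he => ?_) fun e he he' => ?_).trans
      (Finset.sum_congr rfl fun e he => ?_)
    · simp only [Multiset.mem_toFinset, Multiset.mem_filter] at he
      exact Nat.mem_divisors.mpr ⟨he.2, hk.ne'⟩
    · rw [Multiset.mem_toFinset] at he'
      rw [Multiset.count_eq_zero_of_notMem he', zero_smul]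
    · rw [Multiset.count_filter_of_pos (p := (· ∣ k)) (Nat.dvd_of_mem_divisors he), smul_eq_mul]
  ext e
  induction e using Nat.strong_induction_on with
  | _ e ih =>
    rcases Nat.eq_zero_or_pos e with rfl | he
    · rw [Multiset.count_eq_zero_of_notMem fun h0 => (hE _ h0).1.ne' rfl,
        Multiset.count_eq_zero_of_notMem fun h0 => (hE' _ h0).1.ne' rfl]
    -- At `k = e` the proper divisors cancel by induction, leaving the multiplicity of `e` times its
    -- weight.
    have h1 := h e he
    rw [key E e he, key E' e he, ← Nat.cons_self_properDivisors he.ne', Finset.sum_cons,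
      Finset.sum_cons, Finset.sum_congr rfl fun d hd => by
        rw [ih d (Nat.mem_properDivisors.mp hd).2], add_left_inj] at h1
    by_cases hw : 0 < w e
    · exact Nat.eq_of_mul_eq_mul_right hw h1
    · rw [Multiset.count_eq_zero_of_notMem fun h0 => hw (hE _ h0).2,
        Multiset.count_eq_zero_of_notMem fun h0 => hw (hE' _ h0).2]

/-! ### Orders and degrees of irreducible polynomials -/

theorem dvd_X_pow_sub_one_iff_root_pow_eq_one {F : Type*} [Field F] (f : F[X]) (k : ℕ) :
    f ∣ X ^ k - 1 ↔ AdjoinRoot.root f ^ k = 1 := by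
  rw [← AdjoinRoot.mk_eq_zero, map_sub, map_pow, AdjoinRoot.mk_X, map_one, sub_eq_zero]

theorem polyOrder_eq_orderOf_root {F : Type*} [Field F] (f : F[X]) :
    polyOrder f = orderOf (AdjoinRoot.root f) := by
  rw [polyOrder]
  simp_rw [dvd_X_pow_sub_one_iff_root_pow_eq_one]
  -- Both sides default to `0` when no exponent exists.
  rcases Nat.eq_zero_or_pos (orderOf (AdjoinRoot.root f)) with h | h
  · rw [h, Nat.sInf_eq_zero]
    right
    rw [orderOf_eq_zero_iff'] at h
    exact Set.eq_empty_of_forall_notMem fun e he => h e he.1 he.2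
  · exact IsLeast.csInf_eq ⟨⟨h, pow_orderOf_eq_one _⟩, fun e he => orderOf_le_of_pow_eq_one he.1 he.2⟩

theorem polyOrder_dvd_iff {F : Type*} [Field F] (f : F[X]) (k : ℕ) :
    polyOrder f ∣ k ↔ f ∣ X ^ k - 1 := by
  rw [polyOrder_eq_orderOf_root, dvd_X_pow_sub_one_iff_root_pow_eq_one, orderOf_dvd_iff_pow_eq_one]

theorem coprime_card_iff_cast_ne_zero {F : Type*} [Field F] [Finite F] (e : ℕ) :
    e.Coprime (Nat.card F) ↔ (e : F) ≠ 0 := by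
  cases nonempty_fintype F
  obtain ⟨p, hp⟩ := CharP.exists F
  obtain ⟨n, hpp, hn⟩ := FiniteField.card F p
  rw [Nat.card_eq_fintype_card, hn, Nat.coprime_pow_right_iff n.pos, Ne, CharP.cast_eq_zero_iff F p,
    Nat.coprime_comm, hpp.coprime_iff_not_dvd]

theorem polyOrder_eq_iff_dvd_cyclotomic {F : Type*} [Field F] {f : F[X]} (hf : Irreducible f)
    {e : ℕ} (he : (e : F) ≠ 0) : polyOrder f = e ↔ f ∣ cyclotomic e F := by
  have : Fact (Irreducible f) := ⟨hf⟩
  have : NeZero (e : AdjoinRoot f) := ⟨by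
    rw [← map_natCast (algebraMap F (AdjoinRoot f))]
    exact (_root_.map_ne_zero _).mpr he⟩
  rw [polyOrder_eq_orderOf_root, ← IsPrimitiveRoot.iff_orderOf, ← isRoot_cyclotomic_iff,
    ← AdjoinRoot.mk_eq_zero, ← AdjoinRoot.aeval_eq, IsRoot.def,
    ← map_cyclotomic e (algebraMap F (AdjoinRoot f)), eval_map_algebraMap]

theorem natDegree_eq_orderOf_card {F : Type*} [Field F] [Finite F] {f : F[X]} (hf : Irreducible f)
    {e : ℕ} (he : e.Coprime (Nat.card F)) (h : polyOrder f = e) :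
    f.natDegree = orderOf (Nat.card F : ZMod e) := by
  cases nonempty_fintype F
  obtain ⟨p, hp⟩ := CharP.exists F
  obtain ⟨n, hpp, hn⟩ := FiniteField.card F p
  have : Fact p.Prime := ⟨hpp⟩
  have h1 := (coprime_card_iff_cast_ne_zero e).mp he
  have hc : p.Coprime e := by
    rwa [Nat.card_eq_fintype_card, hn, Nat.coprime_pow_right_iff n.pos, Nat.coprime_comm] at he
  rw [natDegree_of_dvd_cyclotomic_of_irreducible hn hc
    ((polyOrder_eq_iff_dvd_cyclotomic hf h1).mp h) hf, ← orderOf_units, ZMod.coe_unitOfCoprime,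
    Nat.card_eq_fintype_card, hn]

theorem isLeast_modEq_one_iff {q e i : ℕ} :
    IsLeast {j : ℕ | 0 < j ∧ q ^ j ≡ 1 [MOD e]} i ↔ 0 < i ∧ orderOf (q : ZMod e) = i := by
  simp_rw [← ZMod.natCast_eq_natCast_iff, Nat.cast_pow, Nat.cast_one]
  constructor
  · rintro ⟨⟨hi, h⟩, hl⟩
    refine ⟨hi, le_antisymm (orderOf_le_of_pow_eq_one hi h) (hl ⟨?_, pow_orderOf_eq_one _⟩)⟩
    exact orderOf_pos_iff.mpr (isOfFinOrder_iff_pow_eq_one.mpr ⟨i, hi, h⟩)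
  · rintro ⟨hi, rfl⟩
    exact ⟨⟨hi, pow_orderOf_eq_one _⟩, fun j hj => orderOf_le_of_pow_eq_one hj.1 hj.2⟩

/-- Since `orderOf` is `0` on non-units mod `e`, positivity of the weight serves below as the
coprimality condition. -/
theorem orderOf_natCast_pos_iff {q e : ℕ} (he : 0 < e) :
    0 < orderOf (q : ZMod e) ↔ e.Coprime q := by
  have : NeZero e := ⟨he.ne'⟩
  rw [Nat.coprime_comm, ← ZMod.isUnit_iff_coprime]
  constructor
  · intro h
    exact IsUnit.of_pow_eq_one (pow_orderOf_eq_one _) h.ne'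
  · rintro ⟨u, hu⟩
    rw [← hu, orderOf_units]
    exact orderOf_pos u

/-! ### Periodic points on one block -/

/-- Numbers of periodic points of an endomorphism with irreducible minimal polynomial of full
degree. -/
theorem card_ptsOfPeriod_of_minpoly {F U : Type*} [Field F] [AddCommGroup U]
    [Module F U] [Module.Finite F U] {A : Module.End F U} {f : F[X]} (hf : Irreducible f)
    (hA : minpoly F A = f) (hd : f.natDegree = Module.finrank F U) (k : ℕ) :
    Nat.card (ptsOfPeriod A k) = if polyOrder f ∣ k then Nat.card F ^ f.natDegree else 1 := by
  have hiff : ∀ v, v ∈ ptsOfPeriod A k ↔ aeval A (X ^ k - 1 : F[X]) v = 0 := fun v => by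
    simp only [map_sub, map_pow, aeval_X, map_one, LinearMap.sub_apply, Module.End.one_apply,
      sub_eq_zero, Module.End.coe_pow]
    rfl
  have hf0 : aeval A f = 0 := hA ▸ minpoly.aeval F A
  split_ifs with h
  · rw [polyOrder_dvd_iff] at h
    obtain ⟨g, hg⟩ := h
    have : ptsOfPeriod A k = Set.univ := Set.eq_univ_of_forall fun v => by
      rw [hiff, hg, map_mul, hf0, zero_mul, LinearMap.zero_apply]
    rw [this, Nat.card_congr (Equiv.Set.univ U), Module.natCard_eq_pow_finrank (K := F), hd]
  · rw [polyOrder_dvd_iff] at h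
    -- By Bézout, `A^k - 1` is injective, so only `0` is fixed.
    obtain ⟨a, b, hab⟩ := (hf.coprime_iff_not_dvd).mpr h
    have : ptsOfPeriod A k = {0} := by
      ext v
      rw [hiff, Set.mem_singleton_iff]
      refine ⟨fun hv => ?_, fun hv => by rw [hv, map_zero]⟩
      have := congrArg (fun g => aeval A g v) hab
      rw [map_add, map_mul, map_mul, hf0, mul_zero, zero_add, map_one, Module.End.mul_apply, hv,
        map_zero] at this
      exact this.symm
    rw [this]
    simp

/-! ### Existence of graph data -/

open scoped DirectSum in
theorem isInternal_range_of_linearEquiv {F V ι : Type*} [Field F] [AddCommGroup V] [Module F V]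
    [DecidableEq ι] {W : ι → Type*} [∀ i, AddCommGroup (W i)] [∀ i, Module F (W i)]
    (ψ : V ≃ₗ[F] ⨁ i, W i) :
    DirectSum.IsInternal
      fun i => LinearMap.range (ψ.symm.toLinearMap ∘ₗ DirectSum.lof F ι W i) := by
  let g : (⨁ i, W i) ≃ₗ[F]
      ⨁ i, LinearMap.range (ψ.symm.toLinearMap ∘ₗ DirectSum.lof F ι W i) :=
    DFinsupp.mapRange.linearEquiv fun i =>
      LinearEquiv.ofInjective (ψ.symm.toLinearMap ∘ₗ DirectSum.lof F ι W i)
        (ψ.symm.injective.comp (DirectSum.of_injective i))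
  have hg : DirectSum.coeLinearMap _ ∘ₗ g.toLinearMap = ψ.symm.toLinearMap := by
    refine DirectSum.linearMap_ext _ fun i => LinearMap.ext fun x => ?_
    have : g (DirectSum.lof F ι W i x) = DirectSum.lof F ι _ i
        (LinearEquiv.ofInjective (ψ.symm.toLinearMap ∘ₗ DirectSum.lof F ι W i)
          (ψ.symm.injective.comp (DirectSum.of_injective i)) x) :=
      DFinsupp.mapRange_single (hf := fun _ => map_zero _)
    simp only [LinearMap.comp_apply, LinearEquiv.coe_coe, this, DirectSum.coeLinearMap_lof]
    rfl
  have hb : Bijective (DirectSum.coeLinearMap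
      fun i => LinearMap.range (ψ.symm.toLinearMap ∘ₗ DirectSum.lof F ι W i)) := by
    rw [← Bijective.of_comp_iff _ g.bijective]
    change Bijective (DirectSum.coeLinearMap _ ∘ₗ g.toLinearMap)
    rw [hg]
    exact ψ.symm.bijective
  exact hb

theorem minpoly_restrict_range {F V W : Type*} [Field F] [AddCommGroup V] [Module F V]
    [AddCommGroup W] [Module F W] {T : Module.End F V} {A : Module.End F W} {φ : W →ₗ[F] V}
    (hφ : Injective φ) (h : ∀ w, T (φ w) = φ (A w))
    (hU : ∀ v ∈ LinearMap.range φ, T v ∈ LinearMap.range φ) :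
    minpoly F (T.restrict hU) = minpoly F A := by
  rw [← minpoly.algEquiv_eq ((LinearEquiv.ofInjective φ hφ).conjAlgEquiv F) A]
  congr 1
  ext ⟨v, w, rfl⟩
  have : (LinearEquiv.ofInjective φ hφ).symm ⟨φ w, w, rfl⟩ = w :=
    (LinearEquiv.symm_apply_eq _).mpr rfl
  simp [LinearEquiv.conjAlgEquiv_apply, this, h]

theorem minpoly_lmul_root {F : Type*} [Field F] {f : F[X]} (hf : f ≠ 0) :
    minpoly F (Algebra.lmul F (AdjoinRoot f) (AdjoinRoot.root f)) =
      f * C f.leadingCoeff⁻¹ := by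
  rw [minpoly.algHom_eq _ Algebra.lmul_injective, AdjoinRoot.minpoly_root hf]

theorem finrank_adjoinRoot {F : Type*} [Field F] {f : F[X]} (hf : f ≠ 0) :
    Module.finrank F (AdjoinRoot f) = f.natDegree := by
  rw [(AdjoinRoot.powerBasis hf).finrank, AdjoinRoot.powerBasis_dim hf]

theorem isGraphData_of_fintype {F V ι : Type*} [Field F] [AddCommGroup V] [Module F V] [Fintype ι]
    [DecidableEq ι] {T : Module.End F V} (U : ι → Submodule F V) (f : ι → F[X]) (s : ι → ℕ)
    (hU : ∀ i, ∀ v ∈ U i, T v ∈ U i) (hint : DirectSum.IsInternal U)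
    (h : ∀ i, 0 < s i ∧ (f i).Monic ∧ Irreducible (f i) ∧ f i ≠ X ∧
      minpoly F (T.restrict (hU i)) = f i ^ s i ∧
      (f i ^ s i).natDegree = Module.finrank F (U i)) :
    ∃ D, IsGraphData T D := by
  let e := (Fintype.equivFin ι).symm
  refine ⟨_, Fintype.card ι, U ∘ e, f ∘ e, s ∘ e, fun i => hU (e i), ?_, fun i => h (e i), rfl⟩
  rw [DirectSum.isInternal_submodule_iff_iSupIndep_and_iSup_eq_top] at hint ⊢
  exact ⟨hint.1.comp e.injective, (e.iSup_comp (g := U)).trans hint.2⟩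

open scoped DirectSum in
/-- Every injective endomorphism of a finite-dimensional space has graph data. -/
theorem exists_isGraphData {F V : Type*} [Field F] [AddCommGroup V] [Module F V]
    [Module.Finite F V] {T : Module.End F V} (hT : Injective T) : ∃ D, IsGraphData T D := by
  classical
  -- Structure theorem for `V` as a torsion `F[X]`-module with `X` acting as `T`.
  obtain ⟨ι, _, p, hp, e, ⟨E⟩⟩ :=
    Module.equiv_directSum_of_isTorsion (Module.AEval.isTorsion_of_finiteDimensional F V T)
  have hpe : ∀ i, p i ^ e i ≠ 0 := fun i => pow_ne_zero _ (hp i).ne_zero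
  let ψ : V ≃ₗ[F] ⨁ i, AdjoinRoot (p i ^ e i) :=
    (Module.AEval'.of T).trans (E.restrictScalars F)
  let φ : ∀ i, AdjoinRoot (p i ^ e i) →ₗ[F] V := fun i =>
    ψ.symm.toLinearMap ∘ₗ DirectSum.lof F ι (fun i => AdjoinRoot (p i ^ e i)) i
  have hφ : ∀ i, Injective (φ i) := fun i => ψ.symm.injective.comp (DirectSum.of_injective i)
  have hTφ : ∀ i w, T (φ i w) = φ i (Algebra.lmul F _ (AdjoinRoot.root (p i ^ e i)) w) := by
    intro i w
    apply ψ.injective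
    let w' : F[X] ⧸ Submodule.span F[X] {p i ^ e i} := w
    have h1 : E (Module.AEval'.of T (φ i w)) =
        DirectSum.lof F[X] ι (fun i => F[X] ⧸ Submodule.span F[X] {p i ^ e i}) i w' :=
      ψ.apply_symm_apply _
    have h2 : ψ (φ i (Algebra.lmul F _ (AdjoinRoot.root (p i ^ e i)) w)) =
        DirectSum.lof F[X] ι (fun i => F[X] ⧸ Submodule.span F[X] {p i ^ e i}) i
          ((X : F[X]) • w') := by
      refine (ψ.apply_symm_apply _).trans ?_
      obtain ⟨g, hg⟩ := AdjoinRoot.mk_surjective w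
      subst hg
      rfl
    rw [h2, map_smul, ← h1, ← map_smul, Module.AEval'.X_smul_of]
    rfl
  have hU : ∀ i, ∀ v ∈ LinearMap.range (φ i), T v ∈ LinearMap.range (φ i) := by
    rintro i _ ⟨w, rfl⟩
    exact ⟨_, (hTφ i w).symm⟩
  have hmin : ∀ i, minpoly F (T.restrict (hU i)) = (p i * C (p i).leadingCoeff⁻¹) ^ e i := by
    intro i
    rw [minpoly_restrict_range (hφ i) (hTφ i) (hU i), minpoly_lmul_root (hpe i), mul_pow,
      leadingCoeff_pow, ← inv_pow, C_pow]
  have hmonic : ∀ i, (p i * C (p i).leadingCoeff⁻¹).Monic := fun i =>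
    monic_mul_leadingCoeff_inv (hp i).ne_zero
  have hdim : ∀ i, ((p i * C (p i).leadingCoeff⁻¹) ^ e i).natDegree =
      Module.finrank F (LinearMap.range (φ i)) := by
    intro i
    rw [LinearMap.finrank_range_of_inj (hφ i), finrank_adjoinRoot (hpe i), natDegree_pow,
      natDegree_pow, natDegree_mul_leadingCoeff_self_inv]
  -- Exponents `e i = 0` may occur; they give zero summands, which are dropped here.
  have hint := DirectSum.isInternal_ne_bot_iff.mpr (isInternal_range_of_linearEquiv ψ)
  refine isGraphData_of_fintype (fun i : {i // LinearMap.range (φ i) ≠ ⊥} => LinearMap.range (φ i))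
    (fun i => p i * C (p i).leadingCoeff⁻¹) (fun i => e i) (fun i => hU i) hint ?_
  rintro ⟨i, hi⟩
  refine ⟨Nat.pos_of_ne_zero fun h0 => hi ?_, hmonic i,
    irreducible_mul_leadingCoeff_inv.mpr (hp i), fun hX => hi ?_, hmin i, hdim i⟩
  · have := hdim i
    exact Submodule.finrank_eq_zero.mp (this.symm.trans (by
      rw [natDegree_pow, show e i = 0 from h0, zero_mul]))
  -- A block with polynomial `X` would make the injective `T` nilpotent there, so the block is zero.
  · have := minpoly.aeval F (T.restrict (hU i))
    rw [hmin i, hX, map_pow, aeval_X] at this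
    rw [eq_bot_iff]
    intro v hv
    have h2 : (T.restrict (hU i) ^ e i) ⟨v, hv⟩ = (T.restrict (hU i) ^ e i) 0 := by
      rw [this]
      rfl
    have h3 : Injective (T.restrict (hU i) ^ e i) := by
      rw [Module.End.coe_pow]
      exact Injective.iterate (fun a b hab => Subtype.ext (hT (congrArg Subtype.val hab))) _
    exact congrArg Subtype.val (h3 h2)

/-! ### Reduction to the multiset of orders -/

theorem card_ptsOfPeriod_of_isInternal {F V ι : Type*} [Field F] [AddCommGroup V] [Module F V]
    [Fintype ι] [DecidableEq ι] {T : Module.End F V} {U : ι → Submodule F V}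
    (hU : ∀ i, ∀ v ∈ U i, T v ∈ U i) (hint : DirectSum.IsInternal U) (k : ℕ) :
    Nat.card (ptsOfPeriod T k) = ∏ i, Nat.card (ptsOfPeriod (T.restrict (hU i)) k) := by
  classical
  rw [← card_ptsOfPeriod_pi]
  let ψ : (∀ i, U i) ≃ V :=
    (DirectSum.addEquivProd fun i => U i).symm.toEquiv.trans (Equiv.ofBijective _ hint)
  have hψ : ∀ u, ψ u = ∑ i, (u i : V) := fun u => by
    change DirectSum.coeAddMonoidHom U ((DirectSum.addEquivProd fun i => U i).symm u) = _
    rw [DirectSum.coeAddMonoidHom_eq_dfinsuppSum, DFinsupp.sum_eq_sum_fintype _ fun _ => rfl]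
    rfl
  refine (card_ptsOfPeriod_congr ψ (fun u => ?_) k).symm
  rw [hψ, hψ, map_sum]
  rfl

/-- The graph data and the numbers of periodic points of a linear map of order prime to the
characteristic are expressed through the multiset of the orders of its elementary divisors. -/
theorem IsGraphData.exists_orders {F V : Type*} [Field F] [Finite F] [AddCommGroup V] [Module F V]
    [Module.Finite F V] {T : Module.End F V} {D : Multiset (ℕ × ℕ × ℕ)} (hD : IsGraphData T D)
    {N : ℕ} (hNF : (N : F) ≠ 0) (hTN : T^[N] = id) :
    ∃ E : Multiset ℕ, D = E.map (fun e => (orderOf (Nat.card F : ZMod e), e, 1)) ∧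
      (∀ e ∈ E, 0 < e ∧ 0 < orderOf (Nat.card F : ZMod e)) ∧
      ∀ k, Nat.card (ptsOfPeriod T k) = Nat.card F ^
        ((E.filter (· ∣ k)).map fun e => orderOf (Nat.card F : ZMod e)).sum := by
  obtain ⟨m, U, f, s, hU, hint, h, rfl⟩ := hD
  have hN : N ≠ 0 := by
    rintro rfl
    exact hNF Nat.cast_zero
  have hdvd : ∀ i, f i ^ s i ∣ X ^ N - 1 := fun i => by
    rw [← (h i).2.2.2.2.1]
    apply minpoly.dvd
    rw [map_sub, map_pow, aeval_X, map_one, sub_eq_zero, Module.End.pow_restrict N (hU i)]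
    ext ⟨v, hv⟩
    change (T ^ N) v = v
    rw [Module.End.coe_pow, hTN, id]
  have hs : ∀ i, s i = 1 := fun i => by
    have hsq : Squarefree (f i ^ s i) :=
      ((X_pow_sub_one_separable_iff.mpr hNF).squarefree).squarefree_of_dvd (hdvd i)
    rcases Squarefree.eq_zero_or_one_of_pow_of_not_isUnit hsq (h i).2.2.1.not_isUnit with h0 | h1
    · exact absurd h0 (h i).1.ne'
    · exact h1
  have hord : ∀ i, polyOrder (f i) ∣ N := fun i => by
    rw [polyOrder_dvd_iff]
    simpa [hs i] using hdvd i
  have hpos : ∀ i, 0 < polyOrder (f i) := fun i => Nat.pos_of_dvd_of_pos (hord i) hN.bot_lt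
  have hcop : ∀ i, (polyOrder (f i)).Coprime (Nat.card F) := fun i =>
    Nat.Coprime.coprime_dvd_left (hord i) ((coprime_card_iff_cast_ne_zero N).mpr hNF)
  have hdeg : ∀ i, (f i).natDegree = orderOf (Nat.card F : ZMod (polyOrder (f i))) := fun i =>
    natDegree_eq_orderOf_card (h i).2.2.1 (hcop i) rfl
  refine ⟨(Finset.univ : Finset (Fin m)).val.map fun i => polyOrder (f i), ?_, ?_, fun k => ?_⟩
  · rw [Multiset.map_map]
    exact Multiset.map_congr rfl fun i _ => by simp only [comp_apply, hs i, hdeg i]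
  · intro e he
    obtain ⟨i, -, rfl⟩ := Multiset.mem_map.mp he
    exact ⟨hpos i, (orderOf_natCast_pos_iff (hpos i)).mpr (hcop i)⟩
  · rw [card_ptsOfPeriod_of_isInternal hU hint, Multiset.filter_map, Multiset.map_map]
    change _ = Nat.card F ^ ∑ i with polyOrder (f i) ∣ k, orderOf (Nat.card F : ZMod (polyOrder (f i)))
    rw [Finset.sum_filter, ← Finset.prod_pow_eq_pow_sum]
    refine Finset.prod_congr rfl fun i _ => ?_
    obtain ⟨-, -, hirr, -, hm, hd⟩ := h i
    rw [hs i, pow_one] at hm hd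
    rw [card_ptsOfPeriod_of_minpoly hirr hm hd, ← hdeg i]
    split_ifs <;> simp

/-! ### Realizing a multiset of orders -/

theorem exists_monic_irreducible_of_order {F : Type*} [Field F] [Finite F] {e : ℕ}
    (he : 0 < e) (hc : e.Coprime (Nat.card F)) :
    ∃ f : F[X], f.Monic ∧ Irreducible f ∧ polyOrder f = e := by
  obtain ⟨f, hm, hf, hd⟩ := exists_monic_irreducible_factor (cyclotomic e F) fun h => by
    have := natDegree_eq_zero_of_isUnit h
    rw [natDegree_cyclotomic] at this
    exact (Nat.totient_pos.mpr he).ne' this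
  exact ⟨f, hm, hf,
    (polyOrder_eq_iff_dvd_cyclotomic hf ((coprime_card_iff_cast_ne_zero e).mp hc)).mpr hd⟩

/-- Every multiset of positive integers prime to `q` is the multiset of orders of a bijective
linear map. -/
theorem exists_end_of_orders {F : Type*} [Field F] [Finite F] (E : Multiset ℕ)
    (hE : ∀ e ∈ E, 0 < e ∧ 0 < orderOf (Nat.card F : ZMod e)) (n : ℕ)
    (hn : (E.map fun e => orderOf (Nat.card F : ZMod e)).sum = n) :
    ∃ T : Module.End F (Fin n → F), Bijective T ∧
      ∀ k, Nat.card (ptsOfPeriod T k) = Nat.card F ^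
        ((E.filter (· ∣ k)).map fun e => orderOf (Nat.card F : ZMod e)).sum := by
  induction E using Multiset.induction_on generalizing n with
  | empty =>
    subst hn
    refine ⟨1, bijective_id, fun k => ?_⟩
    have : Subsingleton (Fin (Multiset.map (fun e : ℕ => orderOf (Nat.card F : ZMod e)) 0).sum → F) :=
      inferInstanceAs (Subsingleton (Fin 0 → F))
    rw [Multiset.filter_zero, Multiset.map_zero, Multiset.sum_zero, pow_zero, Nat.card_eq_one_iff_unique]
    exact ⟨inferInstance, ⟨0, Subsingleton.elim _ _⟩⟩
  | cons e E ih =>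
    obtain ⟨A, hA, hAk⟩ := ih (fun d hd => hE d (Multiset.mem_cons_of_mem hd)) _ rfl
    obtain ⟨he, hw⟩ := hE e (Multiset.mem_cons_self e E)
    have hc := (orderOf_natCast_pos_iff he).mp hw
    obtain ⟨f, hm, hf, hfe⟩ := exists_monic_irreducible_of_order he hc
    have : Fact (Irreducible f) := ⟨hf⟩
    have := hm.finite_adjoinRoot
    have hdeg := natDegree_eq_orderOf_card hf hc hfe
    -- The new block is multiplication by a root of `f` on the field `AdjoinRoot f`.
    let B : Module.End F (AdjoinRoot f) := Algebra.lmul F _ (AdjoinRoot.root f)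
    have hB : minpoly F B = f := by
      rw [minpoly_lmul_root hf.ne_zero, hm.leadingCoeff, inv_one, C_1, mul_one]
    have hroot : AdjoinRoot.root f ≠ 0 := fun h0 => by
      rw [polyOrder_eq_orderOf_root] at hfe
      have := pow_orderOf_eq_one (AdjoinRoot.root f)
      rw [hfe, h0, zero_pow he.ne'] at this
      exact zero_ne_one this
    have hBb : Bijective B := mulLeft_bijective₀ _ hroot
    have hBk := card_ptsOfPeriod_of_minpoly hf hB (finrank_adjoinRoot hf.ne_zero).symm
    rw [Multiset.map_cons, Multiset.sum_cons] at hn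
    let ψ : ((Fin (E.map fun e => orderOf (Nat.card F : ZMod e)).sum → F) × AdjoinRoot f) ≃ₗ[F]
        (Fin n → F) := LinearEquiv.ofFinrankEq _ _ (by
      rw [Module.finrank_prod, Module.finrank_fin_fun, Module.finrank_fin_fun,
        finrank_adjoinRoot hf.ne_zero, hdeg, ← hn, add_comm])
    refine ⟨ψ.conj (A.prodMap B), ?_, fun k => ?_⟩
    · exact ψ.bijective.comp ((hA.prodMap hBb).comp ψ.symm.bijective)
    · rw [← card_ptsOfPeriod_congr (T := Prod.map A B) ψ.toEquiv (fun x => ?_) k,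
        card_ptsOfPeriod_prodMap, hAk, hBk, hfe, hdeg, Multiset.filter_cons]
      · split_ifs <;> simp [pow_add, mul_comm]
      · change ψ (Prod.map A B x) = ψ (A.prodMap B (ψ.symm (ψ x)))
        rw [ψ.symm_apply_apply]
        rfl

/-! ### Counting multisets of orders -/

theorem finite_setOf_isLeast_modEq {q i : ℕ} (hq : 1 < q) :
    {e : ℕ | 0 < e ∧ IsLeast {j : ℕ | 0 < j ∧ q ^ j ≡ 1 [MOD e]} i}.Finite := by
  refine Set.Finite.subset (Nat.divisors (q ^ i - 1)).finite_toSet ?_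
  rintro e ⟨-, ⟨hi, h⟩, -⟩
  rw [Finset.mem_coe, Nat.mem_divisors]
  exact ⟨(Nat.modEq_iff_dvd' (Nat.one_le_pow _ _ (by lia))).mp h.symm,
    (Nat.sub_pos_of_lt (Nat.one_lt_pow hi.ne' hq)).ne'⟩

/-- The choices of `λ_i` integers of multiplicative order `i`, for all partitions `λ` of `n`. -/
abbrev OrderChoice (q n : ℕ) : Type :=
  Σ l : Nat.Partition n, ∀ i : Finset.Icc 1 n,
    Sym {e : ℕ | 0 < e ∧ IsLeast {j : ℕ | 0 < j ∧ q ^ j ≡ 1 [MOD e]} (i : ℕ)}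
      (l.parts.count (i : ℕ))

/-- Natural subtraction gives `0 + 0 - 1 = 0`, which realizes the convention `binom(-1, 0) = 1`. -/
theorem card_orderChoice {q : ℕ} (hq : 1 < q) (n : ℕ) :
    Nat.card (OrderChoice q n) = ∑ l : Nat.Partition n, ∏ i ∈ Finset.Icc 1 n,
        (sigmaStar q i + l.parts.count i - 1).choose (l.parts.count i) := by
  have (i : ℕ) : Finite {e : ℕ | 0 < e ∧ IsLeast {j : ℕ | 0 < j ∧ q ^ j ≡ 1 [MOD e]} i} :=
    finite_setOf_isLeast_modEq hq
  rw [Nat.card_sigma]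
  refine Finset.sum_congr rfl fun l _ => ?_
  rw [Nat.card_pi, ← Finset.prod_coe_sort (Finset.Icc 1 n) fun i =>
    (sigmaStar q i + l.parts.count i - 1).choose (l.parts.count i)]
  refine Finset.prod_congr rfl fun i _ => ?_
  rw [Sym.natCard_sym_eq_choose]
  rfl

/-- The multiset of all chosen integers. -/
def OrderChoice.orders {q n : ℕ} (x : OrderChoice q n) : Multiset ℕ :=
  ∑ i, (x.2 i).1.map Subtype.val

theorem OrderChoice.mem_orders {q n : ℕ} {x : OrderChoice q n} {e : ℕ} (h : e ∈ x.orders) :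
    0 < e ∧ 0 < orderOf (q : ZMod e) := by
  obtain ⟨i, -, hi⟩ := Multiset.mem_sum.mp h
  obtain ⟨⟨e, he⟩, -, rfl⟩ := Multiset.mem_map.mp hi
  obtain ⟨h1, h2⟩ := isLeast_modEq_one_iff.mp he.2
  exact ⟨he.1, h1.trans_eq h2.symm⟩

theorem OrderChoice.sum_orders {q n : ℕ} (x : OrderChoice q n) :
    (x.orders.map fun e => orderOf (q : ZMod e)).sum = n := by
  have h1 : ∀ i : Finset.Icc 1 n,
      (((x.2 i).1.map Subtype.val).map fun e => orderOf (q : ZMod e)).sum =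
        x.1.parts.count (i : ℕ) • (i : ℕ) := by
    intro i
    refine (congrArg Multiset.sum
      ((Multiset.eq_replicate_card (a := (i : ℕ))).mpr fun d hd => ?_)).trans ?_
    · rw [Multiset.map_map] at hd
      obtain ⟨e, -, rfl⟩ := Multiset.mem_map.mp hd
      exact (isLeast_modEq_one_iff.mp e.2.2).2
    · rw [Multiset.sum_replicate, Multiset.card_map, Multiset.card_map]
      exact congrArg (· • (i : ℕ)) (x.2 i).2
  have h2 : (x.orders.map fun e => orderOf (q : ZMod e)).sum =
      ∑ i : Finset.Icc 1 n, x.1.parts.count (i : ℕ) • (i : ℕ) := by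
    rw [OrderChoice.orders, ← Finset.sum_congr rfl fun i _ => h1 i]
    exact map_sum (Multiset.sumAddMonoidHom.comp
      (Multiset.mapAddMonoidHom fun e : ℕ => orderOf (q : ZMod e))) _ _
  rw [h2, Finset.sum_coe_sort (Finset.Icc 1 n) fun i => x.1.parts.count i • i,
    ← Finset.sum_multiset_count_of_subset, x.1.parts_sum]
  intro i hi
  rw [Multiset.mem_toFinset] at hi
  rw [Finset.mem_Icc]
  exact ⟨x.1.parts_pos hi, (Multiset.single_le_sum (fun _ _ => Nat.zero_le _) _ hi).trans_eq
    x.1.parts_sum⟩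

/-- An integer `e` has only one order of `q` mod `e`, so distinct components share no element and
each can be read off from the union. -/
theorem OrderChoice.filter_orders {q n : ℕ} (x : OrderChoice q n) (i : Finset.Icc 1 n) :
    x.orders.filter (fun e => orderOf (q : ZMod e) = i) =
      (x.2 i).1.map Subtype.val := by
  have h1 : x.orders.filter (fun e => orderOf (q : ZMod e) = i) =
      ∑ j, ((x.2 j).1.map Subtype.val).filter (fun e => orderOf (q : ZMod e) = i) :=
    map_sum (⟨⟨Multiset.filter _, Multiset.filter_zero _⟩, Multiset.filter_add _⟩ :
      Multiset ℕ →+ Multiset ℕ) _ _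
  have h2 : ∀ j, ∀ e ∈ (x.2 j).1.map Subtype.val, orderOf (q : ZMod e) = j := by
    intro j e he
    obtain ⟨e, -, rfl⟩ := Multiset.mem_map.mp he
    exact (isLeast_modEq_one_iff.mp e.2.2).2
  rw [h1, Finset.sum_eq_single i]
  · exact Multiset.filter_eq_self.mpr (h2 i)
  · intro j _ hj
    exact Multiset.filter_eq_nil.mpr fun e he h => hj (Subtype.ext ((h2 j e he).symm.trans h))
  · exact fun h => absurd (Finset.mem_univ i) h

theorem OrderChoice.orders_injective {q n : ℕ} :
    Injective (OrderChoice.orders : OrderChoice q n → Multiset ℕ) := by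
  intro x y hxy
  have h : ∀ i, (x.2 i).1.map Subtype.val = (y.2 i).1.map Subtype.val :=
    fun i => by rw [← OrderChoice.filter_orders x i, ← OrderChoice.filter_orders y i, hxy]
  obtain ⟨l, s⟩ := x
  obtain ⟨l', s'⟩ := y
  have hmem : ∀ (l : Nat.Partition n) (i : ℕ), i ∉ Finset.Icc 1 n → l.parts.count i = 0 :=
    fun l i hi => Multiset.count_eq_zero_of_notMem fun hl => hi (Finset.mem_Icc.mpr
      ⟨l.parts_pos hl, (Multiset.single_le_sum (fun _ _ => Nat.zero_le _) _ hl).trans_eq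
        l.parts_sum⟩)
  obtain rfl : l = l' := by
    ext i
    by_cases hi : i ∈ Finset.Icc 1 n
    · simpa using congrArg Multiset.card (h ⟨i, hi⟩)
    · rw [hmem l i hi, hmem l' i hi]
  congr 1
  funext i
  exact Subtype.ext (Multiset.map_injective Subtype.val_injective (h i))

/-! ### The lower bound and the uniqueness of graph data -/

theorem card_ptsOfPeriod_eq_of_iso {X : Type*} {T S : X → X}
    (e : (functionalGraph T).Adj ≃r (functionalGraph S).Adj) (k : ℕ) :
    Nat.card (ptsOfPeriod T k) = Nat.card (ptsOfPeriod S k) :=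
  card_ptsOfPeriod_congr e.toEquiv (fun _ => e.map_rel_iff.mpr rfl) k

theorem sum_prod_choose_le_numBijectiveGraphs (F : Type*) [Field F] [Finite F] (n : ℕ) :
    ∑ l : Nat.Partition n, ∏ i ∈ Finset.Icc 1 n,
        (sigmaStar (Nat.card F) i + l.parts.count i - 1).choose (l.parts.count i) ≤
      numBijectiveGraphs F n := by
  rw [← card_orderChoice Finite.one_lt_card n, numBijectiveGraphs]
  choose T hT hTk using fun x : OrderChoice (Nat.card F) n =>
    exists_end_of_orders (F := F) x.orders (fun e he => x.mem_orders he) n x.sum_orders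
  have : Finite (Module.End F (Fin n → F)) := Finite.of_injective _ DFunLike.coe_injective
  refine Nat.card_le_card_of_injective (fun x => Quotient.mk _ ⟨T x, hT x⟩) fun x y hxy => ?_
  obtain ⟨e⟩ := Quotient.exact hxy
  apply OrderChoice.orders_injective
  refine multiset_eq_of_sum_filter_dvd (fun e => orderOf (Nat.card F : ZMod e))
    (fun e he => x.mem_orders he) (fun e he => y.mem_orders he) fun k _ => ?_
  apply Nat.pow_right_injective (Finite.one_lt_card (α := F))
  change Nat.card F ^ _ = Nat.card F ^ _
  rw [← hTk, ← hTk]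
  exact card_ptsOfPeriod_eq_of_iso e k

/-- The graph data of dynamically equivalent linear maps of order prime to the characteristic
coincide. -/
theorem IsGraphData.eq_of_dynEquiv {F V : Type*} [Field F] [Finite F] [AddCommGroup V] [Module F V]
    [Module.Finite F V] {S T : Module.End F V} (h : DynEquiv T S) {N : ℕ} (hN : (N : F) ≠ 0)
    (hT : T^[N] = id) {DS DT : Multiset (ℕ × ℕ × ℕ)} (hDS : IsGraphData S DS)
    (hDT : IsGraphData T DT) : DS = DT := by
  obtain ⟨f, hf⟩ := h
  have hsemi : Semiconj f S T := fun v => by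
    rw [hf, comp_apply, comp_apply, Equiv.apply_symm_apply]
  have hS : S^[N] = id := funext fun v => f.injective (by
    rw [hsemi.iterate_right N v, hT, id, id])
  obtain ⟨E, rfl, hE, hEk⟩ := hDS.exists_orders hN hS
  obtain ⟨E', rfl, hE', hEk'⟩ := hDT.exists_orders hN hT
  congr 1
  refine multiset_eq_of_sum_filter_dvd (fun e => orderOf (Nat.card F : ZMod e)) hE hE' fun k _ => ?_
  apply Nat.pow_right_injective (Finite.one_lt_card (α := F))
  change Nat.card F ^ _ = Nat.card F ^ _
  rw [← hEk, ← hEk']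
  exact card_ptsOfPeriod_congr f hsemi k

end LinearDynamics

open LinearDynamics in
theorem theorem3p3 (p : ℕ) (F : Type*) [Field F] [Finite F] [CharP F p] (n : ℕ) :
    (∀ S T : Module.End F (Fin n → F), Function.Bijective S → Function.Bijective T →
      DynEquiv T S →
      (∀ m : ℕ, HasCycleOfLength (functionalGraph T) m → ¬ p ∣ m) →
      (∀ m : ℕ, HasCycleOfLength (functionalGraph S) m → ¬ p ∣ m) ∧
      (∃ D, IsGraphData S D) ∧ (∃ D, IsGraphData T D) ∧
      (∀ DS DT : Multiset (ℕ × ℕ × ℕ), IsGraphData S DS → IsGraphData T DT → DS = DT)) ∧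
    ∑ l : Nat.Partition n, ∏ i ∈ Finset.Icc 1 n,
        (sigmaStar (Nat.card F) i + l.parts.count i - 1).choose (l.parts.count i) ≤
      numBijectiveGraphs F n := by
  refine ⟨fun S T hS hT h hc => ⟨fun m hm => hc m (hm.of_dynEquiv h), exists_isGraphData hS.1,
    exists_isGraphData hT.1, fun DS DT hDS hDT => ?_⟩, sum_prod_choose_le_numBijectiveGraphs F n⟩
  obtain ⟨N, -, hN, hTN⟩ := exists_iterate_eq_id hT.1 (CharP.char_is_prime F p) hc
  exact hDS.eq_of_dynEquiv h (mt (CharP.cast_eq_zero_iff F p N).mp hN) hTN hDT
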